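/- Fix constants $a,c\in\mathbb N$. Consider the CONGEST model on an $n$-vertex undirected graph $G=(V,E,w)$ with positive real edge weights, $n\ge 2$, $m=|E|$: in each synchronous round every node may send a (possibly different) message of $O(\log n)$ bits to each of its neighbours; local computation is unrestricted; nodes have private independent fair coins and distinct identifiers in $\{0,\dots,n^a\}$; initially each node knows $n$, the parameters $\ell$ and $W$, its own identifier, and the identifiers of its neighbours together with the weights of the edges to them. A collection of clusters (subsets of $V$) is output by letting every node output the names of the clusters that contain it. For an integer $\ell\ge 1$, a real $W>0$ and a set $L\subseteq\mathbb R$ of lengths, call a finite collection $\mathcal C$ of subsets of $V$ a pairwise cover for the $\ell$-hop paths with length in $L$ if 1. each $C\in\mathcal C$ has strong weighted diameter $O(W\log n)$, i.e. any two vertices of $C$ are joined by a path inside $C$ of weighted length $O(W\log n)$; 2. $\sum_{C\in\mathcal C}|C|=O(n\log n)$ and $\sum_{C\in\mathcal C}|E(C)|=O(m\log n)$, where $E(C)$ is the set of edges with both endpoints in $C$; 3. for every (simple) path $p$ of $G$ with at most $\ell$ edges and weighted length $w(p)\in L$ there is a cluster $C\in\mathcal C$ that contains all vertices of $p$. For $L=(-\infty,W]$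 this is an $\ell$-limited $W$-pairwise cover. **Theorem.** (i) There is a CONGEST algorithm that, for all $n\ge2$, $\ell\ge1$, $W\ge2$ and every such $G$, runs for $O(\ell\log^2 n\,\log W)$ rounds and, with probability at least $1-n^{-c}$, outputs an $\ell$-limited $W$-pairwise cover of $G$. (ii) There is a CONGEST algorithm that, for all $n\ge2$, $\ell\ge1$, $W>0$ and every such $G$, runs for $O(\ell\log^2 n)$ rounds and, with probability at least $1-n^{-c}$, outputs a pairwise cover for the $\ell$-hop paths with length in $[W,2W]$. All constants hidden in the $O$-notation depend only on $a$ and $c$. -/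

import Mathlib

namespace Congest

/-- What a node knows about the graph before the first round: its own identifier and, for each
incident edge, the identifier of the other endpoint together with the weight of the edge. -/
structure LocalInput where
  ident : ℕ
  edges : Set (ℕ × ℝ)

/-- A randomized synchronous message-passing algorithm in which in every round each node sends one
(possibly different) message of `bandwidth` bits to each of its neighbours. All nodes run the same
program. Local computation is unrestricted, each node has `coins` private fair coins, and after
`rounds` rounds each node produces a local output of type `Out`.

Global parameters known to all nodes (such as the number of nodes) are handled by considering
families of such algorithms indexed by these parameters. -/
structure Algorithm (Out : Type) where
  bandwidth : ℕ
  coins : ℕ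
  rounds : ℕ
  State : Type
  /-- initial state, from the local input and the private coins -/
  init : LocalInput → (Fin coins → Bool) → State
  /-- the message for the neighbour that has the given identifier -/
  send : State → ℕ → BitVec bandwidth
  /-- new state, from the set of pairs (identifier of the sender, message) received in a round -/
  receive : State → Set (ℕ × BitVec bandwidth) → State
  output : State → Out

section Execution

variable {n : ℕ} (G : SimpleGraph (Fin n)) (w : Sym2 (Fin n) → ℝ) (ident : Fin n → ℕ)

/-- The local input of the node `v` in the graph `G` with edge weights `w` and identifiers
`ident`. -/
def localInput (v : Fin n) : LocalInput where
  ident := ident v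
  edges := (fun u => (ident u, w s(v, u))) '' G.neighborSet v

/-- An outcome of all the private coins of all the nodes. -/
abbrev Coins {Out : Type} (A : Algorithm Out) (n : ℕ) : Type :=
  Fin n → Fin A.coins → Bool

/-- The state of every node after `t` rounds. -/
def stateAfter {Out : Type} (A : Algorithm Out) (ω : Coins A n) : ℕ → Fin n → A.State
  | 0, v => A.init (localInput G w ident v) (ω v)
  | t + 1, v => A.receive (stateAfter A ω t v)
      ((fun u => (ident u, A.send (stateAfter A ω t u) (ident v))) '' G.neighborSet v)

/-- The outputs of all nodes at the end of the execution. -/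
def run {Out : Type} (A : Algorithm Out) (ω : Coins A n) (v : Fin n) : Out :=
  A.output (stateAfter G w ident A ω A.rounds v)

/-- The probability of an event under independent fair coins. -/
noncomputable def coinProb {Out : Type} (A : Algorithm Out) (n : ℕ) (S : Set (Coins A n)) : ℝ :=
  (ProbabilityTheory.uniformOn (Set.univ : Set (Coins A n))).real S

end Execution

section Covers

variable {n : ℕ} (G : SimpleGraph (Fin n)) (w : Sym2 (Fin n) → ℝ)

/-- The weighted length of a walk. -/
def walkLength {G : SimpleGraph (Fin n)} {u v : Fin n} (p : G.Walk u v) : ℝ :=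
  (p.edges.map w).sum

/-- The (weighted) diameter of the subgraph of `G` induced by `C` is at most `D`
(strong diameter); in particular this subgraph is connected or empty. -/
def StrongDiamLE (C : Set (Fin n)) (D : ℝ) : Prop :=
  ∀ u ∈ C, ∀ v ∈ C, ∃ p : G.Walk u v, (∀ x ∈ p.support, x ∈ C) ∧ walkLength w p ≤ D

/-- The edges of `G` with both endpoints in `C`. -/
def edgesInside (C : Set (Fin n)) : Set (Sym2 (Fin n)) :=
  {e ∈ G.edgeSet | ∀ x ∈ e, x ∈ C}

/-- The clusters `C i`, `i ∈ I`, form a pairwise cover for the paths with at most `ℓ` hops whose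
length lies in `L`: every cluster has diameter at most `D`, the total number of vertices (edges) in
the clusters is at most `S` times the number of vertices (edges) of the graph, and every such path
is contained in some cluster. -/
structure IsPairwiseCover {ι : Type} (ℓ : ℕ) (L : Set ℝ) (D S : ℝ)
    (I : Finset ι) (C : ι → Set (Fin n)) : Prop where
  diam_le : ∀ i ∈ I, StrongDiamLE G w (C i) D
  sum_card_le : ((∑ i ∈ I, (C i).ncard : ℕ) : ℝ) ≤ S * n
  sum_edges_le : ((∑ i ∈ I, (edgesInside G (C i)).ncard : ℕ) : ℝ) ≤ S * G.edgeSet.ncard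
  path_subset : ∀ (u v : Fin n) (p : G.Walk u v), p.IsPath → p.length ≤ ℓ → walkLength w p ∈ L →
    ∃ i ∈ I, ∀ x ∈ p.support, x ∈ C i

/-- If every node outputs the names of the clusters that contain it, these are all the names that
occur. -/
def clusterNames (out : Fin n → Finset ℕ) : Finset ℕ :=
  Finset.univ.biUnion out

/-- If every node outputs the names of the clusters that contain it, this is the cluster with
name `i`. -/
def cluster (out : Fin n → Finset ℕ) (i : ℕ) : Set (Fin n) :=
  {v | i ∈ out v}

/-- The local outputs (names of the clusters that contain the node) describe a pairwise cover. -/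
def OutputsPairwiseCover (ℓ : ℕ) (L : Set ℝ) (D S : ℝ) (out : Fin n → Finset ℕ) : Prop :=
  IsPairwiseCover G w ℓ L D S (clusterNames out) (cluster out)

end Covers

/-- On every `n`-vertex graph with positive edge weights, and for all distinct node identifiers of
size at most `n ^ a`, the algorithm `A` outputs, with probability at least `1 - 1 / n ^ c`, a
pairwise cover for the paths with at most `ℓ` hops whose length lies in `L`, with diameter bound `D`
and overlap bound `S`. -/
def ConstructsCover (A : Algorithm (Finset ℕ)) (a c n ℓ : ℕ) (L : Set ℝ) (D S : ℝ) : Prop :=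
  ∀ (G : SimpleGraph (Fin n)) (w : Sym2 (Fin n) → ℝ) (ident : Fin n → ℕ),
    (∀ e ∈ G.edgeSet, 0 < w e) → Function.Injective ident → (∀ v, ident v ≤ n ^ a) →
    1 - 1 / (n : ℝ) ^ c ≤
      coinProb A n {ω | OutputsPairwiseCover G w ℓ L D S (run G w ident A ω)}

end Congest

/-!
Every vertex draws a geometric random shift, a multiple of `R`, and joins the vertex `z` that
maximizes the shift of `z` minus the distance to `z`, where edge weights are rounded up to multiples
of `W / min ℓ n`. Shortest paths to `z` stay in the cluster of `z`, and shifts are at most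
`R * O(log n)`, so clusters have small strong diameter. If the shift of the chosen `z` happens to be
larger by one more `R`, then `z` also wins at every vertex within distance less than `R / 2` of the
chosen one. As a geometric variable is memoryless, this happens with constant probability, hence
`O(log n)` independent repetitions give every vertex a cluster that contains all the paths in
question starting there, with high probability.

Encoding a shift `s` of the vertex with identifier `i` as the number `s * B + i` with `B` larger
than all identifiers, one maximum propagation of `O(log n)`-bit numbers computes the clusters: the
residue modulo `B` of the number that a vertex ends with is the identifier of the vertex it joins.
-/

namespace Congest

/-! ### Weights of walks -/

section WalkWeight

variable {V M : Type*} {G : SimpleGraph V} {u v x : V}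

section AddCommMonoid

variable [AddCommMonoid M] (d : Sym2 V → M)

/-- The total weight of the edges of a walk, for edge weights in an arbitrary commutative monoid.
For real weights on `Fin n` this is `walkLength` by definition. -/
def walkWeight (p : G.Walk u v) : M :=
  (p.edges.map d).sum

@[simp] lemma walkWeight_nil : walkWeight d (SimpleGraph.Walk.nil : G.Walk u u) = 0 := rfl

@[simp] lemma walkWeight_cons (h : G.Adj u v) (p : G.Walk v x) :
    walkWeight d (SimpleGraph.Walk.cons h p) = d s(u, v) + walkWeight d p := by
  simp [walkWeight]

lemma walkWeight_append (p : G.Walk u v) (q : G.Walk v x) :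
    walkWeight d (p.append q) = walkWeight d p + walkWeight d q := by
  simp [walkWeight, SimpleGraph.Walk.edges_append]

lemma walkWeight_reverse (p : G.Walk u v) : walkWeight d p.reverse = walkWeight d p := by
  simp [walkWeight, SimpleGraph.Walk.edges_reverse, List.sum_reverse]

lemma walkWeight_takeUntil_le [DecidableEq V] [PartialOrder M] [CanonicallyOrderedAdd M]
    (p : G.Walk u v) (h : x ∈ p.support) :
    walkWeight d (p.takeUntil x h) ≤ walkWeight d p := by
  conv_rhs => rw [← p.take_spec h, walkWeight_append]
  exact le_self_add

end AddCommMonoid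

/-- The weights `w` in units of `δ`, rounded up to natural numbers. -/
noncomputable def ceilWeight (δ : ℝ) (w : Sym2 V → ℝ) (e : Sym2 V) : ℕ :=
  ⌈w e / δ⌉₊

variable {δ : ℝ} {w : Sym2 V → ℝ}

lemma ceilWeight_pos (hδ : 0 < δ) {e : Sym2 V} (he : 0 < w e) : 0 < ceilWeight δ w e :=
  Nat.ceil_pos.2 (div_pos he hδ)

lemma le_ceilWeight_mul (hδ : 0 < δ) (e : Sym2 V) : w e ≤ ceilWeight δ w e * δ :=
  (div_le_iff₀ hδ).1 (Nat.le_ceil _)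

lemma ceilWeight_mul_le (hδ : 0 < δ) {e : Sym2 V} (he : 0 ≤ w e) :
    ceilWeight δ w e * δ ≤ w e + δ := by
  calc (ceilWeight δ w e : ℝ) * δ ≤ (w e / δ + 1) * δ := by
        gcongr
        exact (Nat.ceil_lt_add_one (div_nonneg he hδ.le)).le
    _ = w e + δ := by field_simp

lemma walkWeight_le_walkWeight_ceilWeight_mul (hδ : 0 < δ) (p : G.Walk u v) :
    walkWeight w p ≤ walkWeight (ceilWeight δ w) p * δ := by
  induction p with
  | nil => simp
  | cons _ p ih =>
    simp only [walkWeight_cons, Nat.cast_add, add_mul]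
    exact add_le_add (le_ceilWeight_mul hδ _) ih

lemma walkWeight_ceilWeight_mul_le (hδ : 0 < δ) (hw : ∀ e ∈ G.edgeSet, 0 ≤ w e)
    (p : G.Walk u v) :
    walkWeight (ceilWeight δ w) p * δ ≤ walkWeight w p + p.length * δ := by
  induction p with
  | nil => simp
  | cons hadj p ih =>
    have hfirst := ceilWeight_mul_le hδ (hw _ (G.mem_edgeSet.2 hadj))
    simp only [walkWeight_cons, SimpleGraph.Walk.length_cons, Nat.cast_add, Nat.cast_one, add_mul]
    linarith

end WalkWeight

/-! ### Envelopes -/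

section Envelope

variable {V : Type*} {G : SimpleGraph V} {k : Sym2 V → ℕ} {B : ℕ} {a f : V → ℕ}

/-- `f` is the upper envelope `f v = max_u (a u - B * dist(u, v))` of the keys `a`, for the
distance with edge lengths `k`, expressed by local conditions at every vertex. As the decrements
are multiples of `B`, the residue of a key modulo `B` tells where the key comes from. -/
structure IsEnvelope (G : SimpleGraph V) (k : Sym2 V → ℕ) (B : ℕ) (a f : V → ℕ) : Prop where
  le : ∀ v, a v ≤ f v
  le_add_of_adj : ∀ ⦃v u⦄, G.Adj v u → f u ≤ f v + k s(v, u) * B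
  eq_or_exists_adj : ∀ v, f v = a v ∨ ∃ u, G.Adj v u ∧ f u = f v + k s(v, u) * B

namespace IsEnvelope

lemma le_add_walkWeight (h : IsEnvelope G k B a f) {u v : V} (p : G.Walk u v) :
    f v ≤ f u + walkWeight k p * B := by
  induction p with
  | nil => simp
  | cons hadj p ih =>
    have hfirst := h.le_add_of_adj hadj
    rw [walkWeight_cons, add_mul]
    omega

lemma le_add_walkWeight_reverse (h : IsEnvelope G k B a f) {u v : V} (p : G.Walk u v) :
    f u ≤ f v + walkWeight k p * B := by
  simpa only [walkWeight_reverse] using h.le_add_walkWeight p.reverse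

lemma exists_source [Finite V] (h : IsEnvelope G k B a f) (hB : 0 < B)
    (hk : ∀ e ∈ G.edgeSet, 0 < k e) (v : V) :
    ∃ (z : V) (p : G.Walk v z), a z = f v + walkWeight k p * B ∧
      ∀ x ∈ p.support, f x % B = a z % B := by
  obtain ⟨A, hA⟩ := (Set.finite_range f).bddAbove
  have hfA : ∀ v, f v ≤ A := fun v => hA ⟨v, rfl⟩
  induction hgap : A - f v using Nat.strong_induction_on generalizing v with
  | _ gap ih =>
    rcases h.eq_or_exists_adj v with hv | ⟨u, hadj, hu⟩
    · exact ⟨v, .nil, by simp [hv], by simp [hv]⟩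
    · have hstep : 0 < k s(v, u) * B := Nat.mul_pos (hk _ hadj) hB
      have huA := hfA u
      obtain ⟨z, p, hz, hp⟩ := ih (A - f u) (by omega) u rfl
      refine ⟨z, .cons hadj p, by rw [hz, hu, walkWeight_cons]; ring, fun x hx => ?_⟩
      rw [SimpleGraph.Walk.support_cons, List.mem_cons] at hx
      rcases hx with rfl | hx
      · rw [← hp u p.start_mem_support, hu, Nat.add_mul_mod_self_right]
      · exact hp x hx

lemma mod_eq_of_raise_source [Finite V] [DecidableEq V] (h : IsEnvelope G k B a f) (hB : 0 < B)
    (hk : ∀ e ∈ G.edgeSet, 0 < k e) {v z : V} (p : G.Walk v z)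
    (hz : a z = f v + walkWeight k p * B) {R : ℕ} {f' : V → ℕ}
    (h' : IsEnvelope G k B (Function.update a z (a z + R * B)) f') {y : V} (q : G.Walk v y)
    (hq : 2 * walkWeight k q < R) : f' y % B = a z % B := by
  obtain ⟨z', p', hz', hp'⟩ := h'.exists_source hB hk y
  have hres := hp' y p'.start_mem_support
  by_cases hzz : z' = z
  · rw [hres, hzz, Function.update_self, Nat.add_mul_mod_self_right]
  · exfalso
    rw [Function.update_of_ne hzz] at hz'
    have hy : f' y ≤ f y := by
      have := (h.le z').trans (h.le_add_walkWeight p')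
      omega
    have hv : f v + R * B ≤ f' v := by
      have hraised := (h'.le z).trans (h'.le_add_walkWeight p)
      rw [Function.update_self] at hraised
      omega
    have hR : R * B ≤ 2 * walkWeight k q * B := by
      have := h.le_add_walkWeight q
      have := h'.le_add_walkWeight_reverse q
      rw [mul_assoc, two_mul]
      omega
    exact hq.not_ge (Nat.le_of_mul_le_mul_right hR hB)

lemma exists_walk_of_mod_eq [Finite V] (h : IsEnvelope G k B a f) (hB : 0 < B)
    (hk : ∀ e ∈ G.edgeSet, 0 < k e) (hinj : Function.Injective fun v => a v % B) {Q : ℕ}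
    (hQ : ∀ v, a v < (Q + 1) * B) {u v : V} (huv : f u % B = f v % B) :
    ∃ p : G.Walk u v, (∀ x ∈ p.support, f x % B = f v % B) ∧ walkWeight k p ≤ 2 * Q := by
  obtain ⟨x, p, hx, hp⟩ := h.exists_source hB hk u
  obtain ⟨y, q, hy, hq⟩ := h.exists_source hB hk v
  have hux := hp u p.start_mem_support
  have hvy := hq v q.start_mem_support
  obtain rfl : x = y := hinj (hux.symm.trans (huv.trans hvy))
  have weight_le {r s : ℕ} (hrs : a x = r + s * B) : s ≤ Q :=
    Nat.lt_succ_iff.1 (Nat.lt_of_mul_lt_mul_right ((by omega : s * B ≤ a x).trans_lt (hQ x)))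
  refine ⟨p.append q.reverse, fun y hy => ?_, ?_⟩
  · rw [SimpleGraph.Walk.mem_support_append_iff, SimpleGraph.Walk.support_reverse,
      List.mem_reverse] at hy
    rw [hvy]
    exact hy.elim (hp y) (hq y)
  · rw [walkWeight_append, walkWeight_reverse, two_mul]
    exact add_le_add (weight_le hx) (weight_le hy)

end IsEnvelope

/-- The new keys of all vertices after one synchronous round in which every vertex sees the keys
`f` of its neighbours; `a` are the initial keys. Truncated subtraction is harmless, since keys are
never smaller than the initial ones. -/
noncomputable def relax (G : SimpleGraph V) (k : Sym2 V → ℕ) (B : ℕ) (a f : V → ℕ) (v : V) : ℕ :=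
  sSup (insert (a v) ((fun u => f u - k s(v, u) * B) '' G.neighborSet v))

/-- The keys after `t` synchronous rounds of propagation from the initial keys `a`. -/
noncomputable def spread (G : SimpleGraph V) (k : Sym2 V → ℕ) (B : ℕ) (a : V → ℕ) (t : ℕ) :
    V → ℕ :=
  (relax G k B a)^[t] a

lemma spread_succ (t : ℕ) : spread G k B a (t + 1) = relax G k B a (spread G k B a t) :=
  Function.iterate_succ_apply' _ _ _

section Finite

variable [Finite V]

lemma bddAbove_relax (v : V) :
    BddAbove (insert (a v) ((fun u => f u - k s(v, u) * B) '' G.neighborSet v)) :=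
  (((Set.toFinite _).image _).insert _).bddAbove

lemma le_relax (v : V) : a v ≤ relax G k B a f v :=
  le_csSup (bddAbove_relax v) (Set.mem_insert _ _)

lemma le_relax_add_of_adj {v u : V} (h : G.Adj v u) :
    f u ≤ relax G k B a f v + k s(v, u) * B := by
  rw [← Nat.sub_le_iff_le_add]
  exact le_csSup (bddAbove_relax v) (Set.mem_insert_of_mem _ ⟨u, h, rfl⟩)

variable (G k B a f) in
lemma relax_eq_or_exists_adj (v : V) : relax G k B a f v = a v ∨
    ∃ u, G.Adj v u ∧ relax G k B a f v = f u - k s(v, u) * B := by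
  rcases Nat.sSup_mem (Set.insert_nonempty _ _)
    (bddAbove_relax (G := G) (k := k) (B := B) (a := a) (f := f) v) with h | ⟨u, hu, h⟩
  · exact .inl h
  · exact .inr ⟨u, hu, h.symm⟩

lemma relax_mono : Monotone (relax G k B a) := by
  intro f g hfg v
  rcases relax_eq_or_exists_adj G k B a f v with hv | ⟨u, hu, hv⟩
  · exact hv.le.trans (le_relax v)
  · rw [hv, Nat.sub_le_iff_le_add]
    exact (hfg u).trans (le_relax_add_of_adj hu)

variable (G k B a) in
lemma spread_mono : Monotone (spread G k B a) :=
  relax_mono.monotone_iterate_of_le_map fun v => le_relax v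

lemma spread_le {A : ℕ} (hA : ∀ v, a v ≤ A) (t : ℕ) (v : V) : spread G k B a t v ≤ A := by
  induction t generalizing v with
  | zero => exact hA v
  | succ t ih =>
    rw [spread_succ]
    rcases relax_eq_or_exists_adj G k B a (spread G k B a t) v with hv | ⟨u, -, hv⟩
    · exact hv.le.trans (hA v)
    · exact hv.le.trans ((Nat.sub_le _ _).trans (ih u))

lemma exists_adj_of_spread_lt_spread_succ {t : ℕ} {v : V}
    (h : spread G k B a t v < spread G k B a (t + 1) v) :
    ∃ u, G.Adj v u ∧ spread G k B a t u = spread G k B a (t + 1) v + k s(v, u) * B := by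
  have ha : a v ≤ spread G k B a t v := spread_mono G k B a t.zero_le v
  rw [spread_succ] at h ⊢
  rcases relax_eq_or_exists_adj G k B a (spread G k B a t) v with hv | ⟨u, hu, hv⟩
  · omega
  · exact ⟨u, hu, by omega⟩

/-- A key that changes in round `t + 1` has travelled over `t + 1` edges. -/
lemma spread_succ_add_le (hk : ∀ e ∈ G.edgeSet, 0 < k e) {A : ℕ} (hA : ∀ v, a v ≤ A) {t : ℕ}
    {v : V} (h : spread G k B a t v < spread G k B a (t + 1) v) :
    spread G k B a (t + 1) v + (t + 1) * B ≤ A := by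
  induction t generalizing v with
  | zero =>
    obtain ⟨u, hu, heq⟩ := exists_adj_of_spread_lt_spread_succ h
    have hB : B ≤ k s(v, u) * B := Nat.le_mul_of_pos_left _ (hk _ hu)
    have hle := spread_le (G := G) (k := k) (B := B) hA 0 u
    omega
  | succ t ih =>
    obtain ⟨u, hu, heq⟩ := exists_adj_of_spread_lt_spread_succ h
    have hB : B ≤ k s(v, u) * B := Nat.le_mul_of_pos_left _ (hk _ hu)
    have hchanged : spread G k B a t u < spread G k B a (t + 1) u := by
      have hle := le_relax_add_of_adj (k := k) (B := B) (a := a) (f := spread G k B a t) hu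
      rw [← spread_succ] at hle
      omega
    have := ih hchanged
    rw [add_mul (t + 1) 1 B, one_mul]
    omega

lemma isEnvelope_of_relax_eq (h : relax G k B a f = f) : IsEnvelope G k B a f where
  le v := (le_relax v).trans_eq (congrFun h v)
  le_add_of_adj v u hvu := (le_relax_add_of_adj hvu).trans_eq (by rw [h])
  eq_or_exists_adj v := by
    have hle : a v ≤ f v := (le_relax v).trans_eq (congrFun h v)
    rcases relax_eq_or_exists_adj G k B a f v with hv | ⟨u, hu, hv⟩
    · exact .inl (by rwa [h] at hv)
    · rw [h] at hv
      rcases (f v).eq_zero_or_pos with hzero | hpos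
      · exact .inl (by omega)
      · exact .inr ⟨u, hu, by omega⟩

lemma isEnvelope_spread (hk : ∀ e ∈ G.edgeSet, 0 < k e) {Q : ℕ} (hQ : ∀ v, a v < Q * B) :
    IsEnvelope G k B a (spread G k B a Q) := by
  refine isEnvelope_of_relax_eq (le_antisymm (fun v => ?_) ?_) <;> rw [← spread_succ]
  · by_contra! h
    have hle := spread_succ_add_le hk (A := Q * B - 1) (fun v => Nat.le_pred_of_lt (hQ v)) h
    have hlt := hQ v
    rw [add_mul] at hle
    omega
  · exact spread_mono G k B a Q.le_succ

end Finite

end Envelope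

/-! ### Random initial keys and padding -/

section LeadingHeads

variable {m : ℕ}

/-- The number of heads before the first tails in a sequence of coin flips: a geometric random
variable, truncated at `m`. -/
def leadingHeads : {m : ℕ} → (Fin m → Bool) → ℕ
  | 0, _ => 0
  | _ + 1, x => if x 0 then leadingHeads (Fin.tail x) + 1 else 0

lemma leadingHeads_le (x : Fin m → Bool) : leadingHeads x ≤ m := by
  induction m with
  | zero => exact le_rfl
  | succ m ih =>
    rw [leadingHeads]
    split_ifs
    · exact Nat.succ_le_succ (ih _)
    · exact Nat.zero_le _

lemma leadingHeads_init {x : Fin (m + 1) → Bool} (h : x ≠ fun _ => true) :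
    leadingHeads (Fin.init x) = leadingHeads x := by
  induction m with
  | zero =>
    have hx : x 0 = false := by
      by_contra hx
      exact h (funext fun j => by rw [Fin.fin_one_eq_zero j]; simpa using hx)
    simp [leadingHeads, hx]
  | succ m ih =>
    have hhead : Fin.init x 0 = x 0 := rfl
    rw [leadingHeads, hhead, leadingHeads]
    split_ifs with hx
    · have htail : Fin.tail x ≠ fun _ => true := fun htail =>
        h (funext fun j => Fin.cases hx (congrFun htail) j)
      rw [← ih htail]
      rfl
    · rfl

/-- Prepend heads and drop the last coin. -/
def pushHeads (x : Fin (m + 1) → Bool) : Fin (m + 1) → Bool :=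
  Fin.cons (α := fun _ => Bool) true (Fin.init x)

lemma leadingHeads_pushHeads {x : Fin (m + 1) → Bool} (h : x ≠ fun _ => true) :
    leadingHeads (pushHeads x) = leadingHeads x + 1 := by
  rw [leadingHeads]
  simp [pushHeads, leadingHeads_init h]

lemma eq_of_pushHeads_eq {x y : Fin (m + 1) → Bool} (h : pushHeads x = pushHeads y)
    (hlast : x (Fin.last m) = y (Fin.last m)) : x = y := by
  have hinit : Fin.init x = Fin.init y := (Fin.cons_inj.1 h).2
  rw [← Fin.snoc_init_self x, ← Fin.snoc_init_self y, hinit, hlast]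

end LeadingHeads

section Padding

/-- The initial key of a node with identifier `i` and coins `x`: the high-order digit in base `B`
is the random shift, the low-order digit is the identifier. -/
def initialKey (R B i : ℕ) {m : ℕ} (x : Fin m → Bool) : ℕ :=
  R * leadingHeads x * B + i

variable {V : Type*} {G : SimpleGraph V} {k : Sym2 V → ℕ} {B R m : ℕ} {ident : V → ℕ}

lemma initialKey_mod {i : ℕ} (hi : i < B) (x : Fin m → Bool) : initialKey R B i x % B = i := by
  rw [initialKey, Nat.mul_add_mod_self_right, Nat.mod_eq_of_lt hi]

lemma initialKey_lt {i : ℕ} (hi : i < B) (x : Fin m → Bool) :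
    initialKey R B i x < (R * m + 1) * B := by
  calc R * leadingHeads x * B + i < R * m * B + B :=
        add_lt_add_of_le_of_lt (by gcongr; exact leadingHeads_le x) hi
    _ = (R * m + 1) * B := by ring

/-- The initial keys of all nodes. -/
def initialKeys (R B : ℕ) (ident : V → ℕ) (ω : V → Fin m → Bool) (v : V) : ℕ :=
  initialKey R B (ident v) (ω v)

lemma initialKeys_mod (hident : ∀ v, ident v < B) (ω : V → Fin m → Bool) :
    (fun v => initialKeys R B ident ω v % B) = ident :=
  funext fun v => initialKey_mod (hident v) _

/-- The keys that propagation from the random initial keys arrives at. -/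
noncomputable def finalKeys (G : SimpleGraph V) (k : Sym2 V → ℕ) (R B : ℕ) (ident : V → ℕ)
    (ω : V → Fin m → Bool) : V → ℕ :=
  spread G k B (initialKeys R B ident ω) (R * m + 1)

lemma isEnvelope_finalKeys [Finite V] (hk : ∀ e ∈ G.edgeSet, 0 < k e) (hident : ∀ v, ident v < B)
    (ω : V → Fin m → Bool) :
    IsEnvelope G k B (initialKeys R B ident ω) (finalKeys G k R B ident ω) :=
  isEnvelope_spread hk fun v => initialKey_lt (hident v) _

/-- Push heads onto the coins of the node `z` only. -/
def raiseAt [DecidableEq V] (ω : V → Fin (m + 1) → Bool) (z : V) : V → Fin (m + 1) → Bool :=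
  Function.update ω z (pushHeads (ω z))

lemma eq_of_raiseAt_eq [DecidableEq V] {ω ω' : V → Fin (m + 1) → Bool} {z : V}
    (h : raiseAt ω z = raiseAt ω' z) (hlast : ω z (Fin.last m) = ω' z (Fin.last m)) : ω = ω' := by
  funext x
  have hx := congrFun h x
  by_cases hxz : x = z
  · subst hxz
    simp only [raiseAt, Function.update_self] at hx
    exact eq_of_pushHeads_eq hx hlast
  · simpa only [raiseAt, Function.update_of_ne hxz] using hx

lemma initialKeys_raiseAt [DecidableEq V] {ω : V → Fin (m + 1) → Bool} {z : V}
    (h : ω z ≠ fun _ => true) :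
    initialKeys R B ident (raiseAt ω z) =
      Function.update (initialKeys R B ident ω) z (initialKeys R B ident ω z + R * B) := by
  funext x
  by_cases hx : x = z
  · subst hx
    simp only [raiseAt, initialKeys, initialKey, Function.update_self, leadingHeads_pushHeads h]
    ring
  · simp only [raiseAt, initialKeys, Function.update_of_ne hx]

/-- The vertex `v` is padded if its cluster, the set of vertices whose keys have the same residue
modulo `B`, contains all vertices at distance less than `R / 2` from `v`. -/
def Padded (G : SimpleGraph V) (k : Sym2 V → ℕ) (B R : ℕ) (f : V → ℕ) (v : V) : Prop :=
  ∀ ⦃y : V⦄ (q : G.Walk v y), 2 * walkWeight k q < R → f y % B = f v % B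

lemma ncard_setOf_apply_eq_mul {ι α : Type*} [Finite ι] [Finite α] (i : ι) (c : α) :
    {f : ι → α | f i = c}.ncard * Nat.card α = Nat.card (ι → α) := by
  classical
  have := Fintype.ofFinite ι
  have := Fintype.ofFinite α
  have hcard := Fintype.card_filter_piFinset_const_eq_of_mem (Finset.univ : Finset α) i
    (Finset.mem_univ c)
  rw [Fintype.piFinset_univ] at hcard
  rw [Set.ncard_eq_toFinset_card', Set.toFinset_ofPred, hcard, Nat.card_fun, Finset.card_univ,
    Nat.card_eq_fintype_card, Nat.card_eq_fintype_card, ← pow_succ,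
    Nat.sub_add_cancel (Fintype.card_pos_iff.2 ⟨i⟩)]

lemma ncard_setOf_exists_apply_eq_mul_le {ι α : Type*} [Finite ι] [Finite α] (c : α) :
    {f : ι → α | ∃ i, f i = c}.ncard * Nat.card α ≤ Nat.card ι * Nat.card (ι → α) := by
  have := Fintype.ofFinite ι
  calc {f : ι → α | ∃ i, f i = c}.ncard * Nat.card α
      ≤ (∑ i, {f : ι → α | f i = c}.ncard) * Nat.card α := by
        gcongr
        rw [Set.ofPred_exists]
        exact Set.ncard_iUnion_le_of_fintype _
    _ = Nat.card ι * Nat.card (ι → α) := by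
        simp only [Finset.sum_mul, ncard_setOf_apply_eq_mul, Finset.sum_const, Finset.card_univ,
          smul_eq_mul, Nat.card_eq_fintype_card]

variable [Finite V]

/-- Raising the source of the key of `v` makes `v` padded, and the raised outcome of the coins
together with the dropped coin determines the original one: the source is the vertex whose
identifier is the new residue at `v`. -/
lemma ncard_forall_ne_le_ncard_padded_mul_two (hR : 0 < R)
    (hk : ∀ e ∈ G.edgeSet, 0 < k e) (hinj : Function.Injective ident) (hident : ∀ v, ident v < B)
    {f : (V → Fin (m + 1) → Bool) → V → ℕ}
    (hf : ∀ ω, IsEnvelope G k B (initialKeys R B ident ω) (f ω)) (v : V) :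
    {ω : V → Fin (m + 1) → Bool | ∀ u, ω u ≠ fun _ => true}.ncard ≤
      {ω | Padded G k B R (f ω) v}.ncard * 2 := by
  classical
  have hB : 0 < B := (ident v).zero_le.trans_lt (hident v)
  choose z p hz _ using fun ω => (hf ω).exists_source hB hk v
  have mod_raised {ω : V → Fin (m + 1) → Bool} (hω : ∀ u, ω u ≠ fun _ => true) {y : V}
      (q : G.Walk v y) (hq : 2 * walkWeight k q < R) : f (raiseAt ω (z ω)) y % B = ident (z ω) := by
    have hraised := hf (raiseAt ω (z ω))
    rw [initialKeys_raiseAt (hω _)] at hraised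
    rw [(hf ω).mod_eq_of_raise_source hB hk (p ω) (hz ω) hraised q hq]
    exact initialKey_mod (hident _) _
  have mod_raised_self {ω : V → Fin (m + 1) → Bool} (hω : ∀ u, ω u ≠ fun _ => true) :
      f (raiseAt ω (z ω)) v % B = ident (z ω) := mod_raised hω .nil (by simpa using hR)
  have hcard : {ω | Padded G k B R (f ω) v}.ncard * 2 =
      ({ω | Padded G k B R (f ω) v} ×ˢ (Set.univ : Set Bool)).ncard := by
    simp [Set.ncard_prod]
  rw [hcard]
  refine Set.ncard_le_ncard_of_injOn (fun ω => (raiseAt ω (z ω), ω (z ω) (Fin.last m)))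
    (fun ω hω => ⟨fun y q hq => ?_, Set.mem_univ _⟩) fun ω hω ω' hω' heq => ?_
  · exact (mod_raised hω q hq).trans (mod_raised_self hω).symm
  · obtain ⟨hraise, hlast⟩ := Prod.ext_iff.1 heq
    have hzz : z ω = z ω' := hinj <| by
      rw [← mod_raised_self hω, ← mod_raised_self hω']
      exact congrArg (f · v % B) hraise
    dsimp only at hraise hlast
    rw [← hzz] at hraise hlast
    exact eq_of_raiseAt_eq hraise hlast

lemma four_mul_ncard_not_padded_le (hR : 0 < R) (hk : ∀ e ∈ G.edgeSet, 0 < k e)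
    (hinj : Function.Injective ident) (hident : ∀ v, ident v < B) (hm : Nat.card V ≤ 2 ^ m)
    {f : (V → Fin (m + 1) → Bool) → V → ℕ}
    (hf : ∀ ω, IsEnvelope G k B (initialKeys R B ident ω) (f ω)) (v : V) :
    4 * {ω | ¬ Padded G k B R (f ω) v}.ncard ≤ 3 * Nat.card (V → Fin (m + 1) → Bool) := by
  set extreme := {ω : V → Fin (m + 1) → Bool | ∃ u, ω u = fun _ => true}
  have hextreme : 2 * extreme.ncard ≤ Nat.card (V → Fin (m + 1) → Bool) := by
    have hunion : extreme.ncard * 2 ^ (m + 1) ≤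
        Nat.card V * Nat.card (V → Fin (m + 1) → Bool) := by
      simpa using ncard_setOf_exists_apply_eq_mul_le (ι := V) (fun _ : Fin (m + 1) => true)
    refine Nat.le_of_mul_le_mul_left ?_ (Nat.two_pow_pos m)
    calc 2 ^ m * (2 * extreme.ncard) = extreme.ncard * 2 ^ (m + 1) := by ring
      _ ≤ 2 ^ m * _ := hunion.trans (Nat.mul_le_mul_right _ hm)
  have hraise := ncard_forall_ne_le_ncard_padded_mul_two hR hk hinj hident hf v
  have hcompl : extremeᶜ = {ω | ∀ u, ω u ≠ fun _ => true} := by ext; simp [extreme]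
  rw [← hcompl] at hraise
  have hsplit := Set.ncard_add_ncard_compl extreme
  have hpadded := Set.ncard_add_ncard_compl {ω | Padded G k B R (f ω) v}
  rw [Set.compl_ofPred] at hpadded
  omega

end Padding

/-! ### Independent repetitions -/

section Repetition

lemma ncard_setOf_forall_mem {ι Ω : Type*} [Finite ι] (s : Set Ω) :
    {η : ι → Ω | ∀ i, η i ∈ s}.ncard = s.ncard ^ Nat.card ι := by
  rw [← Nat.card_coe_set_eq s, ← Nat.card_fun, ← Nat.card_coe_set_eq]
  exact Nat.card_congr Equiv.subtypePiEquivPi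

lemma ncard_exists_forall_mem_mul_le {ι Ω : Type*} [Finite ι] {p q N T : ℕ}
    (hq : 0 < q) {bad : ι → Set Ω} (hbad : ∀ v, q * (bad v).ncard ≤ p * Nat.card Ω)
    (hT : Nat.card ι * N * p ^ T ≤ q ^ T) :
    {η : Fin T → Ω | ∃ v, ∀ i, η i ∈ bad v}.ncard * N ≤ Nat.card (Fin T → Ω) := by
  have := Fintype.ofFinite ι
  have hbadT : ∀ v, q ^ T * (bad v).ncard ^ T ≤ p ^ T * Nat.card Ω ^ T := fun v => by
    simpa only [mul_pow] using Nat.pow_le_pow_left (hbad v) T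
  have hunion : {η : Fin T → Ω | ∃ v, ∀ i, η i ∈ bad v}.ncard ≤ ∑ v, (bad v).ncard ^ T := by
    rw [Set.ofPred_exists]
    refine (Set.ncard_iUnion_le_of_fintype _).trans_eq ?_
    simp only [ncard_setOf_forall_mem, Nat.card_fin]
  refine Nat.le_of_mul_le_mul_left ?_ (pow_pos hq T)
  calc q ^ T * ({η : Fin T → Ω | ∃ v, ∀ i, η i ∈ bad v}.ncard * N)
      ≤ q ^ T * ((∑ v, (bad v).ncard ^ T) * N) := by gcongr
    _ = (∑ v, q ^ T * (bad v).ncard ^ T) * N := by rw [← Finset.mul_sum, mul_assoc]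
    _ ≤ (∑ _v : ι, p ^ T * Nat.card Ω ^ T) * N :=
        Nat.mul_le_mul_right _ (Finset.sum_le_sum fun v _ => hbadT v)
    _ = Nat.card ι * N * p ^ T * Nat.card Ω ^ T := by
        rw [Finset.sum_const, Finset.card_univ, smul_eq_mul, Nat.card_eq_fintype_card (α := ι)]
        ring
    _ ≤ q ^ T * Nat.card Ω ^ T := by gcongr
    _ = q ^ T * Nat.card (Fin T → Ω) := by rw [Nat.card_fun, Nat.card_fin]

lemma one_sub_le_uniformOn_real {Ω : Type*} [Finite Ω] [Nonempty Ω] [MeasurableSpace Ω]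
    [MeasurableSingletonClass Ω] {S : Set Ω} {N : ℕ} (hN : 0 < N)
    (h : Sᶜ.ncard * N ≤ Nat.card Ω) :
    1 - 1 / (N : ℝ) ≤ (ProbabilityTheory.uniformOn (Set.univ : Set Ω)).real S := by
  have := Fintype.ofFinite Ω
  have hfail : (ProbabilityTheory.uniformOn (Set.univ : Set Ω)).real Sᶜ =
      Sᶜ.ncard / Nat.card Ω := by
    rw [MeasureTheory.measureReal_def, ProbabilityTheory.uniformOn_univ, ENNReal.toReal_div,
      MeasureTheory.Measure.count_apply Sᶜ.toFinite.measurableSet, ← Sᶜ.toFinite.cast_ncard_eq]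
    simp only [ENat.toENNReal_coe, ENNReal.toReal_natCast, Nat.card_eq_fintype_card]
  have hcompl := MeasureTheory.probReal_compl_eq_one_sub
    (μ := ProbabilityTheory.uniformOn (Set.univ : Set Ω)) S.toFinite.measurableSet
  have hle : (Sᶜ.ncard / Nat.card Ω : ℝ) ≤ 1 / N := by
    rw [div_le_div_iff₀ (by exact_mod_cast Nat.card_pos) (by exact_mod_cast hN), one_mul]
    exact_mod_cast h
  linarith

end Repetition

/-! ### The distributed algorithm -/

section JoinedClusters

variable {T B : ℕ}

/-- The names of the clusters of a node that ends the phases with the given keys. A name consists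
of the phase and the low-order digit of the key, which is the identifier of its source. -/
def joinedClusters (B : ℕ) (keys : Fin T → ℕ) : Finset ℕ :=
  Finset.univ.image fun i : Fin T => Nat.pair i (keys i % B)

lemma card_joinedClusters_le (keys : Fin T → ℕ) : (joinedClusters B keys).card ≤ T :=
  Finset.card_image_le.trans_eq (by simp)

lemma pair_mem_joinedClusters {keys : Fin T → ℕ} {i : Fin T} {s : ℕ} :
    Nat.pair i s ∈ joinedClusters B keys ↔ keys i % B = s := by
  simp only [joinedClusters, Finset.mem_image, Finset.mem_univ, true_and, Nat.pair_eq_pair,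
    Fin.val_inj, exists_eq_left]

end JoinedClusters

/-- The coins of a node, divided among the `T` phases. -/
def splitCoins (T m : ℕ) : (Fin (T * m) → Bool) ≃ (Fin T → Fin m → Bool) :=
  (finProdFinEquiv.symm.arrowCongr (Equiv.refl Bool)).trans (Equiv.curry _ _ _)

/-- The coins of all nodes, phase by phase. -/
def phaseCoins (V : Type*) (T m : ℕ) : (V → Fin (T * m) → Bool) ≃ (Fin T → V → Fin m → Bool) :=
  (Equiv.piCongrRight fun _ => splitCoins T m).trans (Equiv.piComm _)

/-- The state of a node in `coverAlgorithm`: the incident edges, the initial keys of all phases,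
the number of elapsed rounds, and the current keys of all phases. -/
structure NodeState (T : ℕ) where
  edges : Set (ℕ × ℝ)
  start : Fin T → ℕ
  time : ℕ
  keys : Fin T → ℕ

/-- The keys in the received messages, each decreased by the length of the edge it arrived on;
the sender's identifier tells which edge that is. -/
def receivedKeys (r : ℝ → ℕ) (B : ℕ) {b : ℕ} (edges : Set (ℕ × ℝ)) (S : Set (ℕ × BitVec b)) :
    Set ℕ :=
  {x | ∃ q ∈ S, ∃ y, (q.1, y) ∈ edges ∧ q.2.toNat - r y * B = x}

/-- In each of `T` phases of `R * m + 1` rounds, the nodes propagate random initial keys, where an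
edge of weight `y` has length `r y`. -/
noncomputable def coverAlgorithm (b T m R B : ℕ) (r : ℝ → ℕ) : Algorithm (Finset ℕ) where
  bandwidth := b
  coins := T * m
  rounds := T * (R * m + 1)
  State := NodeState T
  init input x :=
    { edges := input.edges
      start := fun i => initialKey R B input.ident (splitCoins T m x i)
      time := 0
      keys := fun i => initialKey R B input.ident (splitCoins T m x i) }
  send s _ := BitVec.ofNat b (if h : s.time / (R * m + 1) < T then s.keys ⟨_, h⟩ else 0)
  receive s S :=
    { s with
      time := s.time + 1
      keys := fun i =>
        if (i : ℕ) = s.time / (R * m + 1) then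
          sSup (insert (s.start i) (receivedKeys r B s.edges S))
        else s.keys i }
  output s := joinedClusters B s.keys

section StepsDone

variable {Q i t T : ℕ}

/-- The number of rounds of phase `i` among the first `t` rounds, if every phase takes `Q`
rounds. -/
def stepsDone (Q i t : ℕ) : ℕ :=
  min (t - i * Q) Q

lemma stepsDone_zero : stepsDone Q i 0 = 0 := by
  simp [stepsDone]

lemma stepsDone_succ_of_eq_div (hQ : 0 < Q) (hi : i = t / Q) :
    stepsDone Q i (t + 1) = stepsDone Q i t + 1 := by
  have hmod := Nat.mod_lt t hQ
  have hdiv := Nat.div_add_mod' t Q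
  rw [stepsDone, stepsDone, hi]
  omega

lemma stepsDone_succ_of_ne_div (hQ : 0 < Q) (hi : i ≠ t / Q) :
    stepsDone Q i (t + 1) = stepsDone Q i t := by
  rw [stepsDone, stepsDone]
  rcases Nat.lt_or_gt_of_ne hi with hpast | hfuture
  · have := (Nat.le_div_iff_mul_le hQ).1 hpast
    rw [Nat.succ_mul] at this
    omega
  · have := (Nat.div_lt_iff_lt_mul hQ).1 hfuture
    omega

lemma stepsDone_mul (hi : i < T) : stepsDone Q i (T * Q) = Q := by
  have := Nat.mul_le_mul_right Q hi
  rw [Nat.succ_mul] at this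
  rw [stepsDone]
  omega

end StepsDone

section Execution

variable {n : ℕ} {G : SimpleGraph (Fin n)} {w : Sym2 (Fin n) → ℝ} {ident : Fin n → ℕ}
  {b T m R B : ℕ} {r : ℝ → ℕ}

lemma receivedKeys_localInput (hinj : Function.Injective ident) {f : Fin n → ℕ}
    (hf : ∀ u, f u < 2 ^ b) (v : Fin n) :
    receivedKeys r B (localInput G w ident v).edges
        ((fun u => (ident u, BitVec.ofNat b (f u))) '' G.neighborSet v) =
      (fun u => f u - (r ∘ w) s(v, u) * B) '' G.neighborSet v := by
  have decode (u : Fin n) : (BitVec.ofNat b (f u)).toNat = f u := by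
    rw [BitVec.toNat_ofNat, Nat.mod_eq_of_lt (hf u)]
  ext x
  constructor
  · rintro ⟨_, ⟨u, hu, rfl⟩, y, ⟨u', _, hedge⟩, rfl⟩
    obtain ⟨hident, rfl⟩ := Prod.mk.inj hedge
    obtain rfl := hinj hident
    exact ⟨u', hu, by rw [decode]; rfl⟩
  · rintro ⟨u, hu, rfl⟩
    exact ⟨_, ⟨u, hu, rfl⟩, w s(v, u), ⟨u, hu, rfl⟩, by rw [decode]; rfl⟩

variable (G w ident R B r) in
/-- The state of the node `v` after `t` rounds of `coverAlgorithm`. -/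
noncomputable def nodeStateAfter (ω : Fin n → Fin (T * m) → Bool) (t : ℕ) (v : Fin n) :
    NodeState T where
  edges := (localInput G w ident v).edges
  start i := initialKeys R B ident (phaseCoins _ T m ω i) v
  time := t
  keys i := spread G (r ∘ w) B (initialKeys R B ident (phaseCoins _ T m ω i))
    (stepsDone (R * m + 1) i t) v

lemma spread_initialKeys_lt (hident : ∀ v, ident v < B) (hb : (R * m + 1) * B ≤ 2 ^ b)
    (η : Fin n → Fin m → Bool) (t : ℕ) (v : Fin n) :
    spread G (r ∘ w) B (initialKeys R B ident η) t v < 2 ^ b := by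
  refine (Nat.le_sub_one_iff_lt (Nat.two_pow_pos b)).1 (spread_le (fun u => ?_) t v)
  exact Nat.le_sub_one_of_lt ((initialKey_lt (hident u) _).trans_le hb)

lemma receive_nodeStateAfter (hinj : Function.Injective ident) (hident : ∀ v, ident v < B)
    (hb : (R * m + 1) * B ≤ 2 ^ b) (ω : Fin n → Fin (T * m) → Bool) (t : ℕ) (v : Fin n) :
    (coverAlgorithm b T m R B r).receive (nodeStateAfter G w ident R B r ω t v)
        ((fun u => (ident u, (coverAlgorithm b T m R B r).send
          (nodeStateAfter G w ident R B r ω t u) (ident v))) '' G.neighborSet v) =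
      nodeStateAfter G w ident R B r ω (t + 1) v := by
  have hQ : 0 < R * m + 1 := Nat.succ_pos _
  simp only [coverAlgorithm, nodeStateAfter, NodeState.mk.injEq, true_and]
  funext i
  by_cases hi : (i : ℕ) = t / (R * m + 1)
  · have hphase : t / (R * m + 1) < T := hi ▸ i.2
    obtain rfl : i = ⟨t / (R * m + 1), hphase⟩ := Fin.ext hi
    have hreceived := receivedKeys_localInput (G := G) (w := w) (r := r) (B := B) hinj
      (spread_initialKeys_lt (G := G) (w := w) (r := r) hident hb (phaseCoins _ T m ω ⟨_, hphase⟩)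
        (stepsDone (R * m + 1) (t / (R * m + 1)) t)) v
    rw [stepsDone_succ_of_eq_div hQ rfl, spread_succ, relax, ← hreceived]
    simp only [if_pos, dif_pos hphase]
  · rw [if_neg hi, stepsDone_succ_of_ne_div hQ hi]

lemma stateAfter_coverAlgorithm (hinj : Function.Injective ident) (hident : ∀ v, ident v < B)
    (hb : (R * m + 1) * B ≤ 2 ^ b) (ω : Fin n → Fin (T * m) → Bool) (t : ℕ) (v : Fin n) :
    stateAfter G w ident (coverAlgorithm b T m R B r) ω t v =
      nodeStateAfter G w ident R B r ω t v := by
  induction t generalizing v with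
  | zero =>
    simp only [nodeStateAfter, stepsDone_zero]
    rfl
  | succ t ih =>
    simp only [stateAfter, ih]
    exact receive_nodeStateAfter hinj hident hb ω t v

lemma run_coverAlgorithm (hinj : Function.Injective ident) (hident : ∀ v, ident v < B)
    (hb : (R * m + 1) * B ≤ 2 ^ b) (ω : Fin n → Fin (T * m) → Bool) (v : Fin n) :
    run G w ident (coverAlgorithm b T m R B r) ω v =
      joinedClusters B fun i => finalKeys G (r ∘ w) R B ident (phaseCoins _ T m ω i) v := by
  simp only [run, stateAfter_coverAlgorithm hinj hident hb]
  simp only [coverAlgorithm, nodeStateAfter, stepsDone_mul (Fin.is_lt _), finalKeys]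

end Execution

/-! ### The clusters form a pairwise cover -/

section Cover

lemma sum_ncard_le_mul_ncard {ι α : Type*} {T : ℕ} {E : Set α} (hE : E.Finite) (N : Finset ι)
    {F : ι → Set α} (hFE : ∀ i, F i ⊆ E)
    (hF : ∀ e ∈ E, ∃ s : Finset ι, s.card ≤ T ∧ ∀ i, e ∈ F i → i ∈ s) :
    ∑ i ∈ N, (F i).ncard ≤ T * E.ncard := by
  classical
  lift E to Finset α using hE
  have hncard (i : ι) : (F i).ncard = (E.bipartiteAbove (fun i e => e ∈ F i) i).card := by
    rw [← Set.ncard_coe_finset]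
    congr 1
    ext e
    simpa [Finset.bipartiteAbove] using @hFE i e
  rw [Finset.sum_congr rfl fun i _ => hncard i,
    Finset.sum_card_bipartiteAbove_eq_sum_card_bipartiteBelow, Set.ncard_coe_finset, mul_comm,
    ← smul_eq_mul]
  refine Finset.sum_le_card_nsmul _ _ _ fun e he => ?_
  obtain ⟨s, hs, hes⟩ := hF e he
  exact (Finset.card_le_card fun i hi => hes i (Finset.mem_filter.1 hi).2).trans hs

variable {n : ℕ} {G : SimpleGraph (Fin n)} {w : Sym2 (Fin n) → ℝ} {B Q R T ℓ N : ℕ} {δ : ℝ}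

lemma sum_ncard_cluster_le {out : Fin n → Finset ℕ} (hout : ∀ v, (out v).card ≤ T) :
    ∑ i ∈ clusterNames out, (cluster out i).ncard ≤ T * n := by
  simpa using sum_ncard_le_mul_ncard Set.finite_univ (clusterNames out) (F := cluster out)
    (fun _ => Set.subset_univ _) fun v _ => ⟨out v, hout v, fun _ hi => hi⟩

lemma sum_ncard_edgesInside_cluster_le {out : Fin n → Finset ℕ} (hout : ∀ v, (out v).card ≤ T) :
    ∑ i ∈ clusterNames out, (edgesInside G (cluster out i)).ncard ≤ T * G.edgeSet.ncard := by
  refine sum_ncard_le_mul_ncard G.edgeSet.toFinite _ (fun _ _ he => he.1) fun e _ => ?_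
  induction e with
  | _ x y => exact ⟨out x, hout x, fun i hi => hi.2 x (Sym2.mem_mk_left x y)⟩

lemma IsEnvelope.strongDiamLE {a f : Fin n → ℕ} (h : IsEnvelope G (ceilWeight δ w) B a f)
    (hB : 0 < B) (hδ : 0 < δ) (hw : ∀ e ∈ G.edgeSet, 0 < w e)
    (hinj : Function.Injective fun v => a v % B) (hQ : ∀ v, a v < (Q + 1) * B) (s : ℕ) :
    StrongDiamLE G w {v | f v % B = s} (2 * Q * δ) := by
  intro u hu v hv
  obtain ⟨p, hp, hweight⟩ := h.exists_walk_of_mod_eq hB (fun e he => ceilWeight_pos hδ (hw e he))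
    hinj hQ (Eq.trans hu (Eq.symm hv))
  refine ⟨p, fun x hx => (hp x hx).trans hv, ?_⟩
  calc walkWeight w p ≤ walkWeight (ceilWeight δ w) p * δ :=
        walkWeight_le_walkWeight_ceilWeight_mul hδ p
    _ ≤ 2 * Q * δ := by
        gcongr
        exact_mod_cast hweight

lemma Padded.mod_eq_of_mem_support {f : Fin n → ℕ} {u v x : Fin n}
    (h : Padded G (ceilWeight δ w) B R f u) (hδ : 0 < δ) (hw : ∀ e ∈ G.edgeSet, 0 < w e)
    (hR : 4 * N < R) {p : G.Walk u v} (hlength : p.length ≤ N) (hweight : walkWeight w p ≤ N * δ)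
    (hx : x ∈ p.support) : f x % B = f u % B := by
  have hceil_mul : ((walkWeight (ceilWeight δ w) p : ℕ) : ℝ) * δ ≤ (2 * N : ℕ) * δ :=
    calc ((walkWeight (ceilWeight δ w) p : ℕ) : ℝ) * δ ≤ walkWeight w p + p.length * δ :=
          walkWeight_ceilWeight_mul_le hδ (fun e he => (hw e he).le) p
      _ ≤ N * δ + N * δ := by gcongr
      _ = (2 * N : ℕ) * δ := by push_cast; ring
  have hceil : walkWeight (ceilWeight δ w) p ≤ 2 * N := by
    exact_mod_cast le_of_mul_le_mul_right hceil_mul hδ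
  have htakeUntil := walkWeight_takeUntil_le (ceilWeight δ w) p hx
  exact h (p.takeUntil x hx) (by omega)

lemma outputsPairwiseCover_joinedClusters {a f : Fin T → Fin n → ℕ} (hB : 0 < B) (hδ : 0 < δ)
    (hw : ∀ e ∈ G.edgeSet, 0 < w e) (hf : ∀ i, IsEnvelope G (ceilWeight δ w) B (a i) (f i))
    (hinj : ∀ i, Function.Injective fun v => a i v % B) (hQ : ∀ i v, a i v < (Q + 1) * B)
    (hN : min ℓ n ≤ N) (hR : 4 * N < R)
    (hpad : ∀ v, ∃ i, Padded G (ceilWeight δ w) B R (f i) v) :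
    OutputsPairwiseCover G w ℓ (Set.Iic (N * δ)) (2 * Q * δ) T
      fun v => joinedClusters B fun i => f i v where
  diam_le name hname := by
    obtain ⟨v, -, hv⟩ := Finset.mem_biUnion.1 hname
    obtain ⟨i, -, rfl⟩ := Finset.mem_image.1 hv
    simp only [cluster, pair_mem_joinedClusters]
    exact (hf i).strongDiamLE hB hδ hw (hinj i) (hQ i) _
  sum_card_le := by
    exact_mod_cast sum_ncard_cluster_le fun v => card_joinedClusters_le _
  sum_edges_le := by
    exact_mod_cast sum_ncard_edgesInside_cluster_le fun v => card_joinedClusters_le _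
  path_subset u v p hp hlength hweight := by
    obtain ⟨i, hi⟩ := hpad u
    have hpN : p.length ≤ N := (le_min hlength (by simpa using hp.length_lt.le)).trans hN
    refine ⟨Nat.pair i (f i u % B), Finset.mem_biUnion.2 ⟨u, Finset.mem_univ _, ?_⟩, fun x hx => ?_⟩
    · exact pair_mem_joinedClusters.2 rfl
    · exact pair_mem_joinedClusters.2 (hi.mod_eq_of_mem_support hδ hw hR hpN hweight hx)

end Cover

/-! ### Success with high probability -/

section Probability

variable {a c n ℓ b T m R N : ℕ} {δ : ℝ}

lemma ncard_exists_forall_not_padded_mul_le {V : Type*} [Finite V] {G : SimpleGraph V}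
    {k : Sym2 V → ℕ} {B M : ℕ} {ident : V → ℕ} (hR : 0 < R)
    (hk : ∀ e ∈ G.edgeSet, 0 < k e) (hinj : Function.Injective ident)
    (hident : ∀ v, ident v < B) (hm : Nat.card V ≤ 2 ^ m)
    (hT : Nat.card V * M * 3 ^ T ≤ 4 ^ T) :
    {ω | ∃ v, ∀ i, ¬ Padded G k B R
      (finalKeys G k R B ident (phaseCoins V T (m + 1) ω i)) v}.ncard * M ≤
        Nat.card (V → Fin (T * (m + 1)) → Bool) := by
  set bad : V → Set (V → Fin (m + 1) → Bool) :=
    fun v => {η | ¬ Padded G k B R (finalKeys G k R B ident η) v}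
  have hbad (v : V) : 4 * (bad v).ncard ≤ 3 * Nat.card (V → Fin (m + 1) → Bool) :=
    four_mul_ncard_not_padded_le hR hk hinj hident hm (isEnvelope_finalKeys hk hident) v
  set failures := {η : Fin T → V → Fin (m + 1) → Bool | ∃ v, ∀ i, η i ∈ bad v}
  have hpreimage : (phaseCoins V T (m + 1) ⁻¹' failures).ncard = failures.ncard :=
    Set.ncard_preimage_of_injective_subset_range (Equiv.injective _) (by simp)
  calc (phaseCoins V T (m + 1) ⁻¹' failures).ncard * M = failures.ncard * M := by rw [hpreimage]
    _ ≤ Nat.card (Fin T → V → Fin (m + 1) → Bool) :=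
        ncard_exists_forall_mem_mul_le four_pos hbad hT
    _ = Nat.card (V → Fin (T * (m + 1)) → Bool) := (Nat.card_congr (phaseCoins V T (m + 1))).symm

lemma constructsCover_coverAlgorithm (hn : 0 < n) (hδ : 0 < δ) (hm : n ≤ 2 ^ m)
    (hT : n ^ (c + 1) * 3 ^ T ≤ 4 ^ T) (hb : (R * (m + 1) + 1) * (n ^ a + 1) ≤ 2 ^ b)
    (hN : min ℓ n ≤ N) (hR : 4 * N < R) :
    ConstructsCover (coverAlgorithm b T (m + 1) R (n ^ a + 1) fun x => ⌈x / δ⌉₊) a c n ℓ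
      (Set.Iic (N * δ)) (2 * (R * (m + 1) : ℕ) * δ) T := by
  intro G w ident hw hinj hident
  have hB : 0 < n ^ a + 1 := Nat.succ_pos _
  have hident (v : Fin n) : ident v < n ^ a + 1 := Nat.lt_succ_of_le (hident v)
  have hk : ∀ e ∈ G.edgeSet, 0 < ceilWeight δ w e := fun e he => ceilWeight_pos hδ (hw e he)
  have hfail := ncard_exists_forall_not_padded_mul_le (T := T) (R := R) (m := m) (M := n ^ c)
    (by omega) hk hinj hident (by simpa using hm) (by simpa [← pow_succ'] using hT)
  rw [← Nat.cast_pow]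
  refine one_sub_le_uniformOn_real (Nat.pow_pos hn) (le_trans ?_ hfail)
  refine Nat.mul_le_mul_right _ (Set.ncard_le_ncard fun ω hω => ?_)
  contrapose! hω
  have hpad : ∀ v, ∃ i, Padded G (ceilWeight δ w) (n ^ a + 1) R
      (finalKeys G (ceilWeight δ w) R (n ^ a + 1) ident (phaseCoins _ T (m + 1) ω i)) v := by
    by_contra! hfail
    exact hω hfail
  rw [Set.notMem_compl_iff, Set.mem_ofPred, funext (run_coverAlgorithm hinj hident hb ω)]
  exact outputsPairwiseCover_joinedClusters hB hδ hw (fun i => isEnvelope_finalKeys hk hident _)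
    (fun i => by rwa [initialKeys_mod hident]) (fun i v => initialKey_lt (hident v) _) hN hR hpad

lemma ConstructsCover.mono {A : Algorithm (Finset ℕ)} {L L' : Set ℝ} {D D' S S' : ℝ}
    (h : ConstructsCover A a c n ℓ L D S) (hL : L' ⊆ L) (hD : D ≤ D') (hS : S ≤ S') :
    ConstructsCover A a c n ℓ L' D' S' := by
  intro G w ident hw hinj hident
  refine (h G w ident hw hinj hident).trans (MeasureTheory.measureReal_mono fun ω hω => ?_)
  exact {
    diam_le := fun i hi u hu v hv =>
      let ⟨p, hp, hlength⟩ := hω.diam_le i hi u hu v hv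
      ⟨p, hp, hlength.trans hD⟩
    sum_card_le := hω.sum_card_le.trans (by gcongr)
    sum_edges_le := hω.sum_edges_le.trans (by gcongr)
    path_subset := fun u v p hp hlength hpL => hω.path_subset u v p hp hlength (hL hpL) }

end Probability

/-! ### Choice of the parameters -/

section Parameters

variable {n ℓ : ℕ} {W : ℝ}

lemma clog_two_le_three_mul_log (hn : 2 ≤ n) : (Nat.clog 2 n : ℝ) ≤ 3 * Real.log n := by
  have hclog : 0 < Nat.clog 2 n := Nat.clog_pos one_lt_two hn
  have hpow : (Nat.clog 2 n - 1) * Real.log 2 ≤ Real.log n := by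
    rw [← Nat.cast_pred hclog, ← Real.log_pow]
    exact Real.log_le_log (by positivity)
      (by exact_mod_cast (Nat.pow_pred_clog_lt_self one_lt_two hn).le)
  have hlog : Real.log 2 ≤ Real.log n := Real.log_le_log two_pos (by exact_mod_cast hn)
  nlinarith [Real.log_two_gt_d9]

/-- The instance of `coverAlgorithm` for paths with at most `ℓ` hops and length at most `W`.
Edge weights are measured in units of `W / min ℓ n`, since simple paths have fewer than `n` edges;
with `W / ℓ` instead the keys would not be polynomial in `n`. -/
noncomputable def pairwiseCoverAlgorithm (a c n ℓ : ℕ) (W : ℝ) : Algorithm (Finset ℕ) :=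
  coverAlgorithm (5 + Nat.clog 2 n * (a + 2)) (3 * ((c + 1) * Nat.clog 2 n)) (Nat.clog 2 n + 1)
    (4 * min ℓ n + 1) (n ^ a + 1) fun x => ⌈x / (W / (min ℓ n : ℕ))⌉₊

lemma bandwidth_pairwiseCoverAlgorithm_le (a c ℓ : ℕ) (W : ℝ) (hn : 2 ≤ n) :
    ((pairwiseCoverAlgorithm a c n ℓ W).bandwidth : ℝ) ≤ 21 * (a + 1) * Real.log n := by
  have hclog : 1 ≤ Nat.clog 2 n := Nat.clog_pos one_lt_two hn
  calc ((5 + Nat.clog 2 n * (a + 2) : ℕ) : ℝ) ≤ (7 * (a + 1) * Nat.clog 2 n : ℕ) := by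
        exact_mod_cast (by nlinarith)
    _ = 7 * (a + 1) * (Nat.clog 2 n : ℝ) := by push_cast; ring
    _ ≤ 7 * (a + 1) * (3 * Real.log n) := by gcongr; exact clog_two_le_three_mul_log hn
    _ = 21 * (a + 1) * Real.log n := by ring

lemma rounds_pairwiseCoverAlgorithm_le (a c : ℕ) (W : ℝ) (hn : 2 ≤ n) (hℓ : 1 ≤ ℓ) :
    ((pairwiseCoverAlgorithm a c n ℓ W).rounds : ℝ) ≤
      297 * (c + 1) * (ℓ * Real.log n ^ 2) := by
  have hclog : 1 ≤ Nat.clog 2 n := Nat.clog_pos one_lt_two hn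
  have hphase : (4 * min ℓ n + 1) * (Nat.clog 2 n + 1) + 1 ≤ 11 * (ℓ * Nat.clog 2 n) :=
    calc (4 * min ℓ n + 1) * (Nat.clog 2 n + 1) + 1
        ≤ 5 * ℓ * (2 * Nat.clog 2 n) + ℓ * Nat.clog 2 n :=
          add_le_add (Nat.mul_le_mul (by omega) (by omega)) (Nat.mul_pos hℓ hclog)
      _ = 11 * (ℓ * Nat.clog 2 n) := by ring
  calc ((3 * ((c + 1) * Nat.clog 2 n) * ((4 * min ℓ n + 1) * (Nat.clog 2 n + 1) + 1) : ℕ) : ℝ)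
      ≤ (3 * ((c + 1) * Nat.clog 2 n) * (11 * (ℓ * Nat.clog 2 n)) : ℕ) := by
        exact_mod_cast Nat.mul_le_mul_left _ hphase
    _ = 33 * (c + 1) * ℓ * (Nat.clog 2 n : ℝ) ^ 2 := by push_cast; ring
    _ ≤ 33 * (c + 1) * ℓ * (3 * Real.log n) ^ 2 := by
        gcongr
        exact clog_two_le_three_mul_log hn
    _ = 297 * (c + 1) * (ℓ * Real.log n ^ 2) := by ring

lemma pow_mul_three_pow_le_four_pow {L : ℕ} (hn : n ≤ 2 ^ L) (c : ℕ) :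
    n ^ c * 3 ^ (3 * (c * L)) ≤ 4 ^ (3 * (c * L)) :=
  calc n ^ c * 3 ^ (3 * (c * L)) ≤ (2 ^ L) ^ c * 3 ^ (3 * (c * L)) := by gcongr
    _ = 54 ^ (c * L) := by
        rw [← pow_mul, mul_comm L, pow_mul 3 3, ← mul_pow]
        norm_num
    _ ≤ 64 ^ (c * L) := by gcongr; norm_num
    _ = 4 ^ (3 * (c * L)) := by rw [pow_mul 4 3]; norm_num

lemma keyBound_le_two_pow {L : ℕ} (hn : 1 ≤ n) (hL : L ≤ n) (hnL : n ≤ 2 ^ L) (a ℓ : ℕ) :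
    ((4 * min ℓ n + 1) * (L + 1) + 1) * (n ^ a + 1) ≤ 2 ^ (5 + L * (a + 2)) := by
  have hshift : (4 * min ℓ n + 1) * (L + 1) + 1 ≤ 16 * n ^ 2 :=
    calc (4 * min ℓ n + 1) * (L + 1) + 1 ≤ 5 * n * (2 * n) + n * n :=
          add_le_add (Nat.mul_le_mul (by omega) (by omega)) (Nat.mul_pos hn hn)
      _ ≤ 16 * n ^ 2 := by nlinarith
  have hident : n ^ a + 1 ≤ 2 * n ^ a := by
    have := Nat.one_le_pow a n hn
    omega
  calc ((4 * min ℓ n + 1) * (L + 1) + 1) * (n ^ a + 1) ≤ 16 * n ^ 2 * (2 * n ^ a) :=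
        Nat.mul_le_mul hshift hident
    _ = 2 ^ 5 * n ^ (a + 2) := by ring
    _ ≤ 2 ^ 5 * (2 ^ L) ^ (a + 2) := by gcongr
    _ = 2 ^ (5 + L * (a + 2)) := by rw [← pow_mul, ← pow_add]

lemma constructsCover_pairwiseCoverAlgorithm (a c : ℕ) (hn : 2 ≤ n) (hℓ : 1 ≤ ℓ) (hW : 0 < W) :
    ConstructsCover (pairwiseCoverAlgorithm a c n ℓ W) a c n ℓ (Set.Iic W)
      (60 * (W * Real.log n)) (9 * (c + 1) * Real.log n) := by
  have hclog : (1 : ℝ) ≤ Nat.clog 2 n := by exact_mod_cast Nat.clog_pos one_lt_two hn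
  have hlog := clog_two_le_three_mul_log hn
  have hmin : 1 ≤ min ℓ n := le_min hℓ (by omega)
  have hminR : (1 : ℝ) ≤ (min ℓ n : ℕ) := by exact_mod_cast hmin
  have hmin_pos : (0 : ℝ) < (min ℓ n : ℕ) := zero_lt_one.trans_le hminR
  have hnL : n ≤ 2 ^ Nat.clog 2 n := Nat.le_pow_clog one_lt_two n
  refine (constructsCover_coverAlgorithm (by omega) (div_pos hW hmin_pos) hnL
    (pow_mul_three_pow_le_four_pow hnL _) (keyBound_le_two_pow (by omega)
      (Nat.clog_le_of_le_pow Nat.lt_two_pow_self.le) hnL _ _) le_rfl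
    (by omega)).mono ?_ ?_ ?_
  · rw [mul_div_cancel₀ _ hmin_pos.ne']
  · generalize min ℓ n = N at *
    push_cast
    calc 2 * ((4 * (N : ℝ) + 1) * (Nat.clog 2 n + 1)) * (W / N)
        ≤ 2 * (5 * N * (2 * Nat.clog 2 n)) * (W / N) := by gcongr <;> linarith
      _ = 20 * (W * Nat.clog 2 n) := by field_simp; ring
      _ ≤ 20 * (W * (3 * Real.log n)) := by gcongr
      _ = 60 * (W * Real.log n) := by ring
  · push_cast
    calc 3 * (((c : ℝ) + 1) * Nat.clog 2 n) ≤ 3 * ((c + 1) * (3 * Real.log n)) := by gcongr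
      _ = 9 * (c + 1) * Real.log n := by ring

end Parameters

end Congest

theorem mainTheorem2_general (a c : ℕ) :
    ∃ (K : ℝ) (A : ℕ → ℕ → ℝ → Congest.Algorithm (Finset ℕ)), 0 ≤ K ∧
      ∀ (n ℓ : ℕ) (W : ℝ), 2 ≤ n → 1 ≤ ℓ → 0 < W →
        ((A n ℓ W).bandwidth : ℝ) ≤ K * Real.log n ∧
        ((A n ℓ W).rounds : ℝ) ≤ K * (ℓ * Real.log n ^ 2) ∧
        Congest.ConstructsCover (A n ℓ W) a c n ℓ (Set.Iic W)
          (K * (W * Real.log n)) (K * Real.log n) := by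
  have ha : (1 : ℝ) ≤ a + 1 := by simp
  have hc : (1 : ℝ) ≤ c + 1 := by simp
  have hac : (a + 1 : ℝ) ≤ (a + 1) * (c + 1) := le_mul_of_one_le_right (by positivity) hc
  have hca : (c + 1 : ℝ) ≤ (a + 1) * (c + 1) := le_mul_of_one_le_left (by positivity) ha
  refine ⟨297 * ((a + 1) * (c + 1)), Congest.pairwiseCoverAlgorithm a c, by positivity,
    fun n ℓ W hn hℓ hW => ⟨?_, ?_, ?_⟩⟩
  · refine (Congest.bandwidth_pairwiseCoverAlgorithm_le a c ℓ W hn).trans ?_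
    gcongr ?_ * _
    linarith
  · refine (Congest.rounds_pairwiseCoverAlgorithm_le a c W hn hℓ).trans ?_
    gcongr
  · refine (Congest.constructsCover_pairwiseCoverAlgorithm a c hn hℓ hW).mono subset_rfl ?_ ?_ <;>
    · gcongr ?_ * _
      linarith

theorem mainTheorem2 (a c : ℕ) :
    (∃ (K : ℝ) (A : ℕ → ℕ → ℝ → Congest.Algorithm (Finset ℕ)),
      ∀ (n ℓ : ℕ) (W : ℝ), 2 ≤ n → 1 ≤ ℓ → 2 ≤ W →
        ((A n ℓ W).bandwidth : ℝ) ≤ K * Real.log n ∧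
        ((A n ℓ W).rounds : ℝ) ≤ K * (ℓ * Real.log n ^ 2 * Real.log W) ∧
        Congest.ConstructsCover (A n ℓ W) a c n ℓ (Set.Iic W)
          (K * (W * Real.log n)) (K * Real.log n)) ∧
    (∃ (K : ℝ) (A : ℕ → ℕ → ℝ → Congest.Algorithm (Finset ℕ)),
      ∀ (n ℓ : ℕ) (W : ℝ), 2 ≤ n → 1 ≤ ℓ → 0 < W →
        ((A n ℓ W).bandwidth : ℝ) ≤ K * Real.log n ∧
        ((A n ℓ W).rounds : ℝ) ≤ K * (ℓ * Real.log n ^ 2) ∧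
        Congest.ConstructsCover (A n ℓ W) a c n ℓ (Set.Icc W (2 * W))
          (K * (W * Real.log n)) (K * Real.log n)) := by
  obtain ⟨K, A, hK, hA⟩ := mainTheorem2_general a c
  have hdouble {x : ℝ} (hx : 0 ≤ x) : K * x ≤ 2 * K * x := by gcongr; linarith
  have hlog (n : ℕ) : 0 ≤ Real.log n := Real.log_natCast_nonneg n
  refine ⟨⟨2 * K, A, fun n ℓ W hn hℓ hW => ?_⟩,
    ⟨2 * K, fun n ℓ W => A n ℓ (2 * W), fun n ℓ W hn hℓ hW => ?_⟩⟩
  · obtain ⟨hbandwidth, hrounds, hcover⟩ := hA n ℓ W hn hℓ (by linarith)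
    have hlogW : 1 ≤ 2 * Real.log W := by
      linarith [Real.log_two_gt_d9, Real.log_le_log two_pos hW]
    refine ⟨hbandwidth.trans (hdouble (hlog n)), ?_, hcover.mono subset_rfl
      (hdouble (mul_nonneg (by linarith) (hlog n))) (hdouble (hlog n))⟩
    calc ((A n ℓ W).rounds : ℝ) ≤ K * (ℓ * Real.log n ^ 2) := hrounds
      _ ≤ K * (ℓ * Real.log n ^ 2) * (2 * Real.log W) :=
          le_mul_of_one_le_right (by positivity) hlogW
      _ = 2 * K * (ℓ * Real.log n ^ 2 * Real.log W) := by ring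
  · obtain ⟨hbandwidth, hrounds, hcover⟩ := hA n ℓ (2 * W) hn hℓ (by linarith)
    exact ⟨hbandwidth.trans (hdouble (hlog n)), hrounds.trans (hdouble (by positivity)),
      hcover.mono Set.Icc_subset_Iic_self (by linarith) (hdouble (hlog n))⟩
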